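/- **Setting.** A finite $N$-player multi-objective Markov game (MOMG) $G$ consists of a finite state space $\mathcal S$ with initial state $s_1$, nonempty finite action sets $\mathcal A_1,\dots,\mathcal A_N$ with $\mathcal A=\prod_i\mathcal A_i$, a horizon $H$, transition kernels $P_h:\mathcal S\times\mathcal A\to\Delta(\mathcal S)$ and reward vectors $\boldsymbol r_{j,h}(s,\boldsymbol a)\in[0,1]^M$ for each player $j$ and step $h\le H$, where $M\ge 1$. A joint policy $\pi$ assigns to each step $h$ and each history $(s_1,\boldsymbol a_1,\dots,s_{h-1},\boldsymbol a_{h-1},s_h)$ a distribution $\pi_h(\cdot\mid s_1,\boldsymbol a_1,\dots,s_h)\in\Delta(\mathcal A)$; it is Markov if $\pi_h$ depends on $s_h$ only, i.e. $\pi_h:\mathcal S\to\Delta(\mathcal A)$. Player $j$'s value vector is $\boldsymbol V_{j,1}^{\pi}(s_1)=\mathbb E_{\pi,P}\big[\sum_{h=1}^H \boldsymbol r_{j,h}(s_h,\boldsymbol a_h)\mid s_1\big]\in\mathbb R^M$. For $u,v\in\mathbb R^M$, $u$ Pareto dominates $v$ if $u_m\ge v_m$ for all $m$ and $u_m>v_m$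 for some $m$. A stochastic modification $\phi$ for player $j$ is a family of maps $\phi_h$ that send a history $(s_1,\boldsymbol a_1,\dots,\boldsymbol a_{h-1},s_h)$ and an action of player $j$ to a distribution in $\Delta(\mathcal A_j)$. In the modified joint policy $\phi\circ\pi$, at each step a joint action $\boldsymbol a$ is drawn from $\pi_h$, and then $a_j$ is replaced by an action drawn from $\phi_h(\cdot,a_j)$; histories record the actions actually played. * A joint policy $\pi$ is a *Pareto correlated equilibrium* (PCE) of $G$ if for every player $j$ and every stochastic modification $\phi$ for $j$, $\boldsymbol V_{j,1}^{\phi\circ\pi}(s_1)$ does not Pareto dominate $\boldsymbol V_{j,1}^{\pi}(s_1)$. * A product policy $\pi=(\pi_1,\dots,\pi_N)$ of Markov policies $\pi_{i,h}:\mathcal S\to\Delta(\mathcal A_i)$ is a *Pareto–Nash equilibrium* (PNE) if for no player $k$ there is a Markov policy $\pi_k'$ such that $\boldsymbol V_{k,1}^{(\pi_k',\pi_{-k})}(s_1)$ Pareto dominates $\boldsymbol V_{k,1}^{\pi}(s_1)$. * $\Delta_M^o$ is the set of probability vectors on $\{1,\dots,M\}$ with all entries positive. For $\Lambda=(\lambda^1,\dots,\lambda^N)\in(\Delta_M^o)^N$,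 $G_\Lambda$ is the single-objective Markov game with the same states, actions, horizon, transitions and initial state and with scalar rewards $(\lambda^j)^\top\boldsymbol r_{j,h}$. A joint policy $\pi$ is a *correlated equilibrium* (CE) of $G_\Lambda$ if for every player $j$ and every stochastic modification $\phi$ for $j$, the scalar value of $j$ in $G_\Lambda$ satisfies $V_{j,1}^{\phi\circ\pi}(s_1)\le V_{j,1}^{\pi}(s_1)$. **Theorem.** Let $G$ be a finite MOMG with $M\ge1$ objectives. 1. $G$ has a Pareto correlated equilibrium, and in fact one that is a Markov joint policy. 2. Every PNE of $G$, regarded as a joint policy, is a PCE of $G$. 3. $$\mathbf{PCE}(G)=\bigcup_{\Lambda\in(\Delta_M^o)^N}\mathbf{CE}(G_\Lambda),$$ both when $\mathbf{PCE}$ and $\mathbf{CE}$ denote sets of Markov joint policies and when they denote sets of history-dependent joint policies. -/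

import Mathlib

/-! # Finite-horizon Markov games with vector rewards

`N` players, `M` objectives, horizon `H`, a finite state space `S` and finite action sets `A i`.
The steps `1, …, H` are represented by `Fin H`. Probability distributions on a finite set `X` are the
elements of `stdSimplex ℝ X`. -/

/-- Joint actions `a = (a_1, …, a_N)`. -/
abbrev JointAction {N : ℕ} (A : Fin N → Type*) := ∀ i, A i

/-- A sequence of `n` consecutive state / joint-action pairs. -/
abbrev Trajectory {N : ℕ} (S : Type*) (A : Fin N → Type*) (n : ℕ) := Fin n → S × JointAction A

/-- The part of a trajectory that precedes step `h`. -/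
def Trajectory.past {N H : ℕ} {S : Type*} {A : Fin N → Type*} (τ : Trajectory S A H) (h : Fin H) :
    Trajectory S A h :=
  fun k => τ ⟨k, k.isLt.trans h.isLt⟩

section Policies

variable {N : ℕ} (H : ℕ) (S : Type*) (A : Fin N → Type*) [∀ i, Fintype (A i)]

/-- A (history-dependent, possibly correlated) joint policy: at step `h` it maps the history
`(s_1, a_1, …, s_{h-1}, a_{h-1}, s_h)` to a distribution over joint actions. -/
abbrev JointPolicy :=
  ∀ h : Fin H, Trajectory S A h → S → stdSimplex ℝ (JointAction A)

/-- A Markov joint policy: at each step, a map `S → Δ(A)` to distributions over joint actions. -/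
abbrev MarkovJointPolicy :=
  Fin H → S → stdSimplex ℝ (JointAction A)

/-- A (Markov, stochastic) policy of the single player `i`. -/
abbrev PlayerPolicy (i : Fin N) :=
  Fin H → S → stdSimplex ℝ (A i)

/-- A stochastic modification for player `j`: at step `h` it maps the history
`(s_1, a_1, …, s_{h-1}, a_{h-1}, s_h)` and the action of player `j` that was sampled from the original
policy to a distribution over the actions of player `j`. -/
abbrev StochasticModification (j : Fin N) :=
  ∀ h : Fin H, Trajectory S A h → S → A j → stdSimplex ℝ (A j)

end Policies

section Operations

variable {N H : ℕ} {S : Type*} {A : Fin N → Type*} [∀ i, Fintype (A i)]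

/-- A Markov joint policy, seen as a joint policy that ignores the past. -/
def MarkovJointPolicy.toJointPolicy (π : MarkovJointPolicy H S A) : JointPolicy H S A :=
  fun h _ s => π h s

/-- The product distribution of a family of distributions. -/
def productDist (μ : ∀ i, stdSimplex ℝ (A i)) : stdSimplex ℝ (JointAction A) :=
  ⟨fun a => ∏ i, μ i (a i), fun a => Finset.prod_nonneg fun i _ => (μ i).2.1 (a i), by
    have h := Finset.prod_univ_sum (fun i => (Finset.univ : Finset (A i)))
      (fun i x => (μ i) x)
    rw [Fintype.piFinset_univ] at h
    rw [← h]
    exact Finset.prod_eq_one fun i _ => (μ i).2.2⟩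

/-- The product policy `(π_1, …, π_N)`: all players randomize independently. -/
def productPolicy (π : ∀ i, PlayerPolicy H S A i) : MarkovJointPolicy H S A :=
  fun h s => productDist fun i => π i h s

open Classical in
/-- Draw a joint action `a` from `μ`, draw `b` from `ψ (a j)`, and replace the `j`-th entry of `a`
by `b`. -/
noncomputable def modifyDist (j : Fin N) (ψ : A j → stdSimplex ℝ (A j))
    (μ : stdSimplex ℝ (JointAction A)) : stdSimplex ℝ (JointAction A) :=
  ⟨fun a' => ∑ a : JointAction A, ∑ b : A j,
      if Function.update a j b = a' then μ a * ψ (a j) b else 0,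
    fun a' => Finset.sum_nonneg fun a _ => Finset.sum_nonneg fun b _ => by
      split_ifs
      · exact mul_nonneg (μ.2.1 a) ((ψ (a j)).2.1 b)
      · exact le_rfl, by
    rw [Finset.sum_comm]
    have key : ∀ a : JointAction A,
        (∑ a' : JointAction A, ∑ b : A j,
          if Function.update a j b = a' then μ a * ψ (a j) b else 0) = μ a := by
      intro a
      rw [Finset.sum_comm]
      simp only [Finset.sum_ite_eq, Finset.mem_univ, if_true]
      rw [← Finset.mul_sum]
      have h1 : ∑ b : A j, ψ (a j) b = 1 := (ψ (a j)).2.2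
      rw [h1, mul_one]
    simp only [key]
    exact μ.2.2⟩

/-- The modified joint policy `φ ∘ π`: player `j` passes the action sampled from `π` through `φ`, all
the other players play as before. -/
noncomputable def StochasticModification.comp {j : Fin N} (φ : StochasticModification H S A j)
    (π : JointPolicy H S A) : JointPolicy H S A :=
  fun h past s => modifyDist j (φ h past s) (π h past s)

variable [Fintype S]

open Classical in
/-- The conditional probability of the state `s_h` of the trajectory `τ` given what precedes it:
the first state is `s₁`, and later states are drawn from the transition kernel. -/
noncomputable def stateProb (P : Fin H → S → JointAction A → stdSimplex ℝ S) (s₁ : S)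
    (τ : Trajectory S A H) (h : Fin H) : ℝ :=
  if h.val = 0 then
    if (τ h).1 = s₁ then 1 else 0
  else
    let k : Fin H := ⟨h.val - 1, (Nat.sub_le _ _).trans_lt h.isLt⟩
    P k (τ k).1 (τ k).2 (τ h).1

/-- The probability of the trajectory `τ` under the joint policy `π`, the transition kernel `P` and
the initial state `s₁`. -/
noncomputable def trajectoryProb (P : Fin H → S → JointAction A → stdSimplex ℝ S) (s₁ : S)
    (π : JointPolicy H S A) (τ : Trajectory S A H) : ℝ :=
  ∏ h : Fin H, stateProb P s₁ τ h * π h (τ.past h) (τ h).1 (τ h).2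

/-- The expected cumulative reward `𝔼_{π, P} [∑_{h = 1}^H ρ_h(s_h, a_h) | s_1 = s₁]`. -/
noncomputable def expectedReturn (P : Fin H → S → JointAction A → stdSimplex ℝ S) (s₁ : S)
    (ρ : Fin H → S → JointAction A → ℝ) (π : JointPolicy H S A) : ℝ :=
  ∑ τ : Trajectory S A H, trajectoryProb P s₁ π τ * ∑ h : Fin H, ρ h (τ h).1 (τ h).2

end Operations

section Games

/-- A finite-horizon single-objective Markov game with scalar rewards in `[0, 1]`. -/
structure MarkovGame (N H : ℕ) (S : Type*) (A : Fin N → Type*) [Fintype S] where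
  /-- transition kernel -/
  P : Fin H → S → JointAction A → stdSimplex ℝ S
  /-- rewards -/
  r : Fin N → Fin H → S → JointAction A → ℝ
  r_mem : ∀ j h s a, r j h s a ∈ Set.Icc (0 : ℝ) 1
  /-- initial state -/
  s₁ : S

/-- A finite-horizon multi-objective Markov game with reward vectors in `[0, 1]^M`. -/
structure MOMG (N M H : ℕ) (S : Type*) (A : Fin N → Type*) [Fintype S] where
  /-- transition kernel -/
  P : Fin H → S → JointAction A → stdSimplex ℝ S
  /-- reward vectors -/
  r : Fin N → Fin H → S → JointAction A → Fin M → ℝ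
  r_mem : ∀ j h s a m, r j h s a m ∈ Set.Icc (0 : ℝ) 1
  /-- initial state -/
  s₁ : S

/-- `u` Pareto dominates `v`. -/
def ParetoDominates {M : ℕ} (u v : Fin M → ℝ) : Prop :=
  (∀ m, v m ≤ u m) ∧ ∃ m, v m < u m

/-- The set `Δ_M^o` of probability vectors on `M` objectives with positive entries. -/
def openSimplex (M : ℕ) : Set (Fin M → ℝ) :=
  {w | w ∈ stdSimplex ℝ (Fin M) ∧ ∀ m, 0 < w m}

variable {N M H : ℕ} {S : Type*} {A : Fin N → Type*} [Fintype S] [∀ i, Fintype (A i)]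

/-- The value `V_{j,1}^π(s_1)` of player `j`. -/
noncomputable def MarkovGame.value (G : MarkovGame N H S A) (π : JointPolicy H S A) (j : Fin N) : ℝ :=
  expectedReturn G.P G.s₁ (G.r j) π

/-- The set of correlated equilibria: no player gains by a stochastic modification. -/
def MarkovGame.CE (G : MarkovGame N H S A) : Set (JointPolicy H S A) :=
  {π | ∀ (j : Fin N) (φ : StochasticModification H S A j), G.value (φ.comp π) j ≤ G.value π j}

/-- The value vector `V_{j,1}^π(s_1)` of player `j`, with one entry per objective. -/
noncomputable def MOMG.value (G : MOMG N M H S A) (π : JointPolicy H S A) (j : Fin N) : Fin M → ℝ :=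
  fun m => expectedReturn G.P G.s₁ (fun h s a => G.r j h s a m) π

/-- The set of Pareto correlated equilibria: no stochastic modification of a player leads to a value
vector that Pareto dominates the player's original one. -/
def MOMG.PCE (G : MOMG N M H S A) : Set (JointPolicy H S A) :=
  {π | ∀ (j : Fin N) (φ : StochasticModification H S A j),
    ¬ ParetoDominates (G.value (φ.comp π) j) (G.value π j)}

/-- The set of Pareto-Nash equilibria: profiles `(π_1, …, π_N)` of policies such that no unilateral
deviation leads to a value vector that Pareto dominates the deviating player's original one. -/
def MOMG.PNE (G : MOMG N M H S A) : Set (∀ i, PlayerPolicy H S A i) :=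
  {π | ∀ (k : Fin N) (π' : PlayerPolicy H S A k),
    ¬ ParetoDominates
      (G.value (productPolicy (Function.update π k π')).toJointPolicy k)
      (G.value (productPolicy π).toJointPolicy k)}

/-- The linearly scalarized game `G_Λ`, in which player `j` has the scalar reward `(λ^j)ᵀ r_j`. -/
def MOMG.scalarize (G : MOMG N M H S A) (Λ : Fin N → openSimplex M) : MarkovGame N H S A where
  P := G.P
  r j h s a := ∑ m, (Λ j).1 m * G.r j h s a m
  r_mem j h s a := by
    refine ⟨Finset.sum_nonneg fun m _ => mul_nonneg ((Λ j).2.1.1 m) (G.r_mem j h s a m).1, ?_⟩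
    calc ∑ m, (Λ j).1 m * G.r j h s a m ≤ ∑ m, (Λ j).1 m :=
          Finset.sum_le_sum fun m _ =>
            mul_le_of_le_one_right ((Λ j).2.1.1 m) (G.r_mem j h s a m).2
      _ = 1 := (Λ j).2.1.2
  s₁ := G.s₁

end Games

/-! Positive weights turn Pareto domination into a strict gain of the weighted sum, so an
equilibrium of a scalarized game is a Pareto correlated equilibrium. The converse rests on
polyhedrality. For fixed `π` and `j`, the value vectors of all `φ ∘ π` form a polytope. An
undominated point of a general convex set may be supported only by weights with zeros, but for a
polytope Farkas' lemma yields strictly positive weights (`exists_openSimplex_forall_convexHull_le`).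

The polytope is found at the level of history laws. One further step is a bilinear function of the
present law and of the modification used there, and the latter ranges over a product of simplices;
hence finitely many laws span the rest (`exists_finite_historyLaws_subset`). Convexity holds because
a mixture of two modifications can be played by weighting them with their posterior probabilities
given the history (`convex_historyLaws`).

Existence follows by scalarizing with any positive weights and playing, by backward induction, a
correlated equilibrium of each stage game. Stage equilibria come from the Hart–Schmeidler duality
argument.

For a Pareto–Nash equilibrium the opponents play independently and look at the state only. Averaging
a modification over the histories that lead to a state then gives a Markov deviation with the same
occupancies, hence the same values. -/

/-! ### Theorems of the alternative for finite linear systems -/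

section LinearInequalities

/-- **Farkas' lemma** for finitely many linear functionals on a real vector space. -/
theorem exists_nonneg_eq_sum_smul_fin {V : Type*} [AddCommGroup V] [Module ℝ V] {n : ℕ}
    (a : Fin n → V →ₗ[ℝ] ℝ) (b : V →ₗ[ℝ] ℝ) (h : ∀ x, (∀ i, a i x ≤ 0) → b x ≤ 0) :
    ∃ c : Fin n → ℝ, (∀ i, 0 ≤ c i) ∧ b = ∑ i, c i • a i := by
  induction n generalizing b with
  | zero =>
    refine ⟨0, fun i => i.elim0, ?_⟩
    ext x
    have h1 := h x fun i => i.elim0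
    have h2 := h (-x) fun i => i.elim0
    rw [map_neg] at h2
    simp only [Finset.univ_eq_empty, Finset.sum_empty, LinearMap.zero_apply]
    linarith
  | succ n ih =>
    by_cases h' : ∀ x, (∀ i : Fin n, a i.succ x ≤ 0) → b x ≤ 0
    · obtain ⟨c, hc, hb⟩ := ih (fun i => a i.succ) b h'
      refine ⟨Fin.cons 0 c, fun i => ?_, ?_⟩
      · refine Fin.cases ?_ (fun i => ?_) i
        · simp
        · simpa using hc i
      · rw [Fin.sum_univ_succ]
        simpa using hb
    · push Not at h'
      obtain ⟨z, hz, hbz⟩ := h'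
      have haz : 0 < a 0 z := by
        by_contra hle
        refine absurd (h z fun i => ?_) (not_le.2 hbz)
        exact Fin.cases (not_lt.1 hle) hz i
      -- Subtracting multiples of `a 0` makes all functionals vanish at `z`. Their value at `x` is
      -- then that of the original ones at the projection of `x` along `z` to the kernel of `a 0`,
      -- where `h` applies.
      obtain ⟨c, hc, hb⟩ := ih (fun i => a i.succ - (a i.succ z / a 0 z) • a 0)
        (b - (b z / a 0 z) • a 0) (by
          intro x hx
          have key := h (x - (a 0 x / a 0 z) • z) (by
            intro i
            refine Fin.cases ?_ (fun i => ?_) i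
            · simp only [map_sub, map_smul, smul_eq_mul]
              rw [div_mul_cancel₀ _ haz.ne', sub_self]
            · have := hx i
              simp only [LinearMap.sub_apply, LinearMap.smul_apply, smul_eq_mul, map_sub,
                map_smul] at this ⊢
              convert this using 2
              ring)
          simp only [LinearMap.sub_apply, LinearMap.smul_apply, smul_eq_mul, map_sub,
            map_smul] at key ⊢
          convert key using 2
          ring)
      refine ⟨Fin.cons (b z / a 0 z - ∑ i, c i * (a i.succ z / a 0 z)) c, fun i => ?_, ?_⟩
      · refine Fin.cases ?_ (fun i => ?_) i
        · have h1 : ∑ i, c i * (a i.succ z / a 0 z) ≤ 0 :=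
            Finset.sum_nonpos fun i _ =>
              mul_nonpos_of_nonneg_of_nonpos (hc i) (div_nonpos_of_nonpos_of_nonneg (hz i) haz.le)
          have h2 : 0 < b z / a 0 z := div_pos hbz haz
          simp only [Fin.cons_zero]
          linarith
        · simpa using hc i
      · rw [Fin.sum_univ_succ]
        simp only [Fin.cons_zero, Fin.cons_succ]
        ext x
        have := LinearMap.congr_fun hb x
        simp only [LinearMap.sub_apply, LinearMap.smul_apply, smul_eq_mul, LinearMap.sum_apply,
          LinearMap.add_apply, mul_sub, Finset.sum_sub_distrib] at this ⊢
        rw [sub_mul, Finset.sum_mul]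
        have e : ∑ i, c i * (a i.succ z / a 0 z * a 0 x) = ∑ i, c i * (a i.succ z / a 0 z) * a 0 x :=
          Finset.sum_congr rfl fun i _ => by ring
        linarith

theorem exists_nonneg_eq_sum_smul {V ι : Type*} [AddCommGroup V] [Module ℝ V] [Fintype ι]
    (a : ι → V →ₗ[ℝ] ℝ) (b : V →ₗ[ℝ] ℝ) (h : ∀ x, (∀ i, a i x ≤ 0) → b x ≤ 0) :
    ∃ c : ι → ℝ, (∀ i, 0 ≤ c i) ∧ b = ∑ i, c i • a i := by
  let e := Fintype.equivFin ι
  obtain ⟨c, hc, hb⟩ := exists_nonneg_eq_sum_smul_fin (fun k => a (e.symm k)) b fun x hx =>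
    h x fun i => by simpa using hx (e i)
  refine ⟨fun i => c (e i), fun i => hc _, ?_⟩
  rw [hb, ← e.sum_comp]
  simp

/-- **Ville's theorem of the alternative.** -/
theorem exists_stdSimplex_sum_nonpos {ι κ : Type*} [Fintype ι] [Fintype κ] (g : ι → κ → ℝ)
    (h : ∀ y : κ → ℝ, (∀ k, 0 ≤ y k) → ∃ i, ∑ k, y k * g i k ≤ 0) :
    ∃ p : stdSimplex ℝ ι, ∀ k, ∑ i, p i * g i k ≤ 0 := by
  classical
  -- For pairs `(y, t)`, the constraints `0 ≤ y` and `t ≤ ∑ k, g i k * y k` for all `i` force `t ≤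
  -- 0`. The multipliers of the second kind form `p`: evaluation at `(0, 1)` gives total mass one,
  -- and at `(e_k, 0)` the inequality for `k`.
  obtain ⟨c, hc, hb⟩ := exists_nonneg_eq_sum_smul (V := (κ → ℝ) × ℝ) (ι := ι ⊕ κ)
    (Sum.elim
      (fun i => LinearMap.snd ℝ (κ → ℝ) ℝ -
        (∑ k, g i k • (LinearMap.proj k : (κ → ℝ) →ₗ[ℝ] ℝ)) ∘ₗ LinearMap.fst ℝ (κ → ℝ) ℝ)
      (fun k => -((LinearMap.proj k : (κ → ℝ) →ₗ[ℝ] ℝ) ∘ₗ LinearMap.fst ℝ (κ → ℝ) ℝ)))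
    (LinearMap.snd ℝ (κ → ℝ) ℝ) (by
      rintro ⟨y, t⟩ hx
      obtain ⟨i, hi⟩ := h y fun k => by simpa using hx (Sum.inr k)
      have h1 := hx (Sum.inl i)
      simp only [Sum.elim_inl, LinearMap.sub_apply, LinearMap.snd_apply, LinearMap.comp_apply,
        LinearMap.fst_apply, LinearMap.sum_apply, LinearMap.smul_apply, LinearMap.proj_apply,
        smul_eq_mul] at h1
      simp only [LinearMap.snd_apply]
      have e : ∑ k, g i k * y k = ∑ k, y k * g i k := Finset.sum_congr rfl fun k _ => mul_comm _ _
      linarith)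
  refine ⟨⟨fun i => c (Sum.inl i), fun i => hc _, ?_⟩, fun k => ?_⟩
  · have := LinearMap.congr_fun hb (0, 1)
    simpa [Fintype.sum_sum_type, LinearMap.sum_apply] using this.symm
  · have := LinearMap.congr_fun hb (Pi.single k 1, 0)
    simp only [Fintype.sum_sum_type, LinearMap.sum_apply, LinearMap.add_apply,
      LinearMap.smul_apply, LinearMap.sub_apply, LinearMap.snd_apply, LinearMap.comp_apply,
      LinearMap.fst_apply, LinearMap.proj_apply, LinearMap.neg_apply, Sum.elim_inl, Sum.elim_inr,
      Pi.single_apply, smul_eq_mul, mul_ite, mul_one, mul_zero, Finset.sum_ite_eq',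
      Finset.mem_univ, if_true, zero_sub, mul_neg, Finset.sum_neg_distrib] at this
    have h2 := hc (Sum.inr k)
    change ∑ i, c (Sum.inl i) * g i k ≤ 0
    linarith

/-- A finite rate matrix has a stationary distribution. -/
theorem exists_stationary_stdSimplex {X : Type*} [Fintype X] [Nonempty X] (y : X → X → ℝ)
    (hy : ∀ x b, 0 ≤ y x b) :
    ∃ q : stdSimplex ℝ X, ∀ f : X → ℝ, ∑ x, q x * ∑ b, y x b * (f b - f x) = 0 := by
  classical
  have hgen : ∀ (f : X → ℝ) x,
      ∑ b, f b * (y x b - if b = x then ∑ b', y x b' else 0) = ∑ b, y x b * (f b - f x) := by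
    intro f x
    simp only [mul_sub, mul_ite, mul_zero, Finset.sum_sub_distrib, Finset.sum_ite_eq',
      Finset.mem_univ, if_true, Finset.mul_sum]
    simp only [mul_comm]
  -- Maximum principle: the generator applied to `f` is nonpositive where `f` is maximal. The
  -- resulting inequalities for `q` are equalities, since the rows of the generator sum to zero.
  obtain ⟨q, hq⟩ := exists_stdSimplex_sum_nonpos
    (fun x b => y x b - if b = x then ∑ b', y x b' else 0) (by
      intro f _
      obtain ⟨x, hx⟩ := Finite.exists_max f
      refine ⟨x, ?_⟩
      rw [hgen]
      exact Finset.sum_nonpos fun b _ =>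
        mul_nonpos_of_nonneg_of_nonpos (hy x b) (sub_nonpos.2 (hx b)))
  have hsum : ∑ b, ∑ x, q x * (y x b - if b = x then ∑ b', y x b' else 0) = 0 := by
    rw [Finset.sum_comm]
    refine Finset.sum_eq_zero fun x _ => ?_
    rw [← Finset.mul_sum, Finset.sum_sub_distrib]
    simp
  have hzero := (Finset.sum_eq_zero_iff_of_nonpos fun b _ => hq b).1 hsum
  refine ⟨q, fun f => ?_⟩
  calc ∑ x, q x * ∑ b, y x b * (f b - f x)
      = ∑ x, ∑ b, f b * (q x * (y x b - if b = x then ∑ b', y x b' else 0)) := by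
        refine Finset.sum_congr rfl fun x _ => ?_
        rw [← hgen, Finset.mul_sum]
        exact Finset.sum_congr rfl fun b _ => mul_left_comm _ _ _
    _ = ∑ b, f b * ∑ x, q x * (y x b - if b = x then ∑ b', y x b' else 0) := by
        rw [Finset.sum_comm]
        simp only [Finset.mul_sum]
    _ = 0 := Finset.sum_eq_zero fun b hb => by rw [hzero b hb, mul_zero]

/-- A finite family of vectors none of whose nonnegative combinations is nonnegative and nonzero
admits a supporting functional with positive coefficients. -/
theorem exists_pos_forall_sum_mul_nonpos {ι κ : Type*} [Fintype ι] [Fintype κ] (g : ι → κ → ℝ)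
    (h : ∀ c : ι → ℝ, (∀ i, 0 ≤ c i) → (∀ k, 0 ≤ ∑ i, c i * g i k) → ∀ k, ∑ i, c i * g i k ≤ 0) :
    ∃ w : κ → ℝ, (∀ k, 0 < w k) ∧ ∀ i, ∑ k, w k * g i k ≤ 0 := by
  classical
  -- Only one coordinate at a time needs to be positive, since the solutions can be added. If it
  -- cannot be, Farkas' lemma gives a nonnegative combination of the `g i` that dominates `e_m`,
  -- against `h`.
  have key : ∀ m : κ, ∃ w : κ → ℝ, (∀ k, 0 ≤ w k) ∧ 0 < w m ∧ ∀ i, ∑ k, w k * g i k ≤ 0 := by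
    intro m
    by_contra hne
    push Not at hne
    obtain ⟨c, hc, hb⟩ := exists_nonneg_eq_sum_smul (V := κ → ℝ) (ι := ι ⊕ κ)
      (Sum.elim (fun i => ∑ k, g i k • (LinearMap.proj k : (κ → ℝ) →ₗ[ℝ] ℝ))
        (fun k => -(LinearMap.proj k : (κ → ℝ) →ₗ[ℝ] ℝ)))
      (LinearMap.proj m) (by
        intro w hw
        by_contra hpos
        obtain ⟨i, hi⟩ := hne w (fun k => by simpa using hw (Sum.inr k)) (not_le.1 hpos)
        have h1 := hw (Sum.inl i)
        simp only [Sum.elim_inl, LinearMap.sum_apply, LinearMap.smul_apply, LinearMap.proj_apply,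
          smul_eq_mul] at h1
        have e : ∑ k, g i k * w k = ∑ k, w k * g i k :=
          Finset.sum_congr rfl fun k _ => mul_comm _ _
        linarith)
    have hk : ∀ k, ∑ i, c (Sum.inl i) * g i k = (if k = m then 1 else 0) + c (Sum.inr k) := by
      intro k
      have := LinearMap.congr_fun hb (Pi.single k 1)
      simp [Fintype.sum_sum_type, LinearMap.sum_apply, Pi.single_apply, eq_comm] at this
      simp only [eq_comm (a := k)]
      linarith
    have h1 := h (fun i => c (Sum.inl i)) (fun i => hc _) (fun k => by
      rw [hk]
      have := hc (Sum.inr k)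
      split_ifs <;> linarith) m
    rw [hk] at h1
    have := hc (Sum.inr m)
    simp only [if_true] at h1
    linarith
  choose w hw0 hw1 hw2 using key
  refine ⟨fun k => ∑ m, w m k, fun k => ?_, fun i => ?_⟩
  · exact Finset.sum_pos' (fun m _ => hw0 m k) ⟨k, Finset.mem_univ k, hw1 k⟩
  · simp only [Finset.sum_mul]
    rw [Finset.sum_comm]
    exact Finset.sum_nonpos fun m _ => hw2 m i

end LinearInequalities

/-! ### Laws of histories, occupancies and Bellman inequalities -/

section HistoryLaws

variable {N H : ℕ} {S : Type*} {A : Fin N → Type*} [Fintype S]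

open Classical in
/-- The law of the state that follows a history of `n` state / joint-action pairs. -/
noncomputable def stateKernel (P : Fin H → S → JointAction A → stdSimplex ℝ S) (s₁ : S) :
    ∀ n, n ≤ H → Trajectory S A n → S → ℝ
  | 0, _, _, s => if s = s₁ then 1 else 0
  | n + 1, hn, τ, s => P ⟨n, hn⟩ (τ (Fin.last n)).1 (τ (Fin.last n)).2 s

section

variable (P : Fin H → S → JointAction A → stdSimplex ℝ S) (s₁ : S)

theorem stateKernel_nonneg (n : ℕ) (hn : n ≤ H) (τ : Trajectory S A n) (s : S) :
    0 ≤ stateKernel P s₁ n hn τ s := by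
  cases n with
  | zero =>
    simp only [stateKernel]
    split_ifs <;> norm_num
  | succ n => exact (P _ _ _).2.1 s

theorem sum_stateKernel (n : ℕ) (hn : n ≤ H) (τ : Trajectory S A n) :
    ∑ s, stateKernel P s₁ n hn τ s = 1 := by
  cases n with
  | zero =>
    classical
    simp [stateKernel, Finset.sum_ite_eq']
  | succ n => exact (P _ _ _).2.2

end

variable [∀ i, Fintype (A i)]

/-- The probability of a history of `n` state / joint-action pairs under `π`. -/
noncomputable def historyProb (P : Fin H → S → JointAction A → stdSimplex ℝ S) (s₁ : S)
    (π : JointPolicy H S A) : ∀ n, n ≤ H → Trajectory S A n → ℝ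
  | 0, _, _ => 1
  | n + 1, hn, τ =>
    historyProb P s₁ π n (Nat.le_of_succ_le hn) (Fin.init τ) *
      (stateKernel P s₁ n (Nat.le_of_succ_le hn) (Fin.init τ) (τ (Fin.last n)).1 *
        π ⟨n, hn⟩ (Fin.init τ) (τ (Fin.last n)).1 (τ (Fin.last n)).2)

/-- The probability that the state after `n` steps is `s`. -/
noncomputable def stateMarginal (P : Fin H → S → JointAction A → stdSimplex ℝ S) (s₁ : S)
    (π : JointPolicy H S A) (n : ℕ) (hn : n ≤ H) (s : S) : ℝ :=
  ∑ τ : Trajectory S A n, historyProb P s₁ π n hn τ * stateKernel P s₁ n hn τ s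

/-- The probability that the state is `s` and the joint action is `a` at step `h`. -/
noncomputable def occupancy (P : Fin H → S → JointAction A → stdSimplex ℝ S) (s₁ : S)
    (π : JointPolicy H S A) (h : Fin H) (s : S) (a : JointAction A) : ℝ :=
  ∑ τ : Trajectory S A h, historyProb P s₁ π h h.isLt.le τ *
    stateKernel P s₁ h h.isLt.le τ s * π h τ s a

variable (P : Fin H → S → JointAction A → stdSimplex ℝ S) (s₁ : S)

theorem historyProb_nonneg (π : JointPolicy H S A) (n : ℕ) (hn : n ≤ H) (τ : Trajectory S A n) :
    0 ≤ historyProb P s₁ π n hn τ := by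
  induction n with
  | zero => exact zero_le_one
  | succ n ih =>
    exact mul_nonneg (ih _ _) (mul_nonneg (stateKernel_nonneg P s₁ _ _ _ _) ((π _ _ _).2.1 _))

theorem historyProb_congr {π π' : JointPolicy H S A} (n : ℕ) (hn : n ≤ H)
    (h : ∀ k : Fin H, k.val < n → π k = π' k) :
    historyProb P s₁ π n hn = historyProb P s₁ π' n hn := by
  induction n with
  | zero => rfl
  | succ n ih =>
    funext τ
    simp only [historyProb]
    rw [ih (Nat.le_of_succ_le hn) fun k hk => h k (hk.trans n.lt_succ_self),
      h ⟨n, hn⟩ n.lt_succ_self]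

theorem trajectoryProb_eq_historyProb (π : JointPolicy H S A) (τ : Trajectory S A H) :
    trajectoryProb P s₁ π τ = historyProb P s₁ π H le_rfl τ := by
  have key : ∀ n (hn : n ≤ H), historyProb P s₁ π n hn (fun k => τ (Fin.castLE hn k)) =
      ∏ k : Fin n, stateProb P s₁ τ (Fin.castLE hn k) *
        π (Fin.castLE hn k) (τ.past (Fin.castLE hn k)) (τ (Fin.castLE hn k)).1
          (τ (Fin.castLE hn k)).2 := by
    intro n
    induction n with
    | zero => intro hn; simp [historyProb]
    | succ n ih =>
      intro hn
      rw [Fin.prod_univ_castSucc]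
      simp only [historyProb]
      refine congrArg₂ _ (ih (Nat.le_of_succ_le hn)) (congrArg₂ _ ?_ rfl)
      cases n with
      | zero => simp [stateKernel, stateProb, Fin.castLE]
      | succ n => simp [stateKernel, stateProb, Fin.castLE, Fin.init]
  exact (key H le_rfl).symm

theorem sum_trajectory_succ {n : ℕ} (f : Trajectory S A (n + 1) → ℝ) :
    ∑ τ, f τ = ∑ τ : Trajectory S A n, ∑ s : S, ∑ a : JointAction A,
      f (Fin.snoc (α := fun _ => S × JointAction A) τ (s, a)) := by
  rw [← (Fin.snocEquiv fun _ : Fin (n + 1) => S × JointAction A).sum_comp, Fintype.sum_prod_type,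
    Finset.sum_comm]
  refine Finset.sum_congr rfl fun τ _ => ?_
  rw [Fintype.sum_prod_type]
  rfl

theorem sum_historyProb_succ (π : JointPolicy H S A) (n : ℕ) (hn : n < H)
    (f : Trajectory S A (n + 1) → ℝ) :
    ∑ τ, historyProb P s₁ π (n + 1) hn τ * f τ =
      ∑ τ : Trajectory S A n, historyProb P s₁ π n hn.le τ *
        ∑ s, stateKernel P s₁ n hn.le τ s * ∑ a, π ⟨n, hn⟩ τ s a *
          f (Fin.snoc (α := fun _ => S × JointAction A) τ (s, a)) := by
  rw [sum_trajectory_succ]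
  simp only [historyProb, Fin.init_snoc, Fin.snoc_last, Finset.mul_sum, mul_assoc]

theorem stateMarginal_nonneg (π : JointPolicy H S A) (n : ℕ) (hn : n ≤ H) (s : S) :
    0 ≤ stateMarginal P s₁ π n hn s :=
  Finset.sum_nonneg fun _ _ =>
    mul_nonneg (historyProb_nonneg P s₁ _ _ _ _) (stateKernel_nonneg P s₁ _ _ _ _)

open Classical in
theorem stateMarginal_zero (π : JointPolicy H S A) (hn : 0 ≤ H) (s : S) :
    stateMarginal P s₁ π 0 hn s = if s = s₁ then 1 else 0 := by
  simp [stateMarginal, historyProb, stateKernel]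

theorem stateMarginal_succ (π : JointPolicy H S A) (n : ℕ) (hn : n < H) (s' : S) :
    stateMarginal P s₁ π (n + 1) hn s' =
      ∑ s, ∑ a, occupancy P s₁ π ⟨n, hn⟩ s a * P ⟨n, hn⟩ s a s' := by
  unfold stateMarginal
  rw [sum_historyProb_succ]
  simp only [stateKernel, Fin.snoc_last, occupancy, Finset.mul_sum, Finset.sum_mul]
  rw [Finset.sum_comm]
  refine Finset.sum_congr rfl fun s _ => ?_
  rw [Finset.sum_comm]
  refine Finset.sum_congr rfl fun a _ => Finset.sum_congr rfl fun τ _ => ?_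
  ring

/-- Linearity of expectation: the policy enters the return only through its one-step laws, because
summing out a later step leaves the earlier rewards unchanged. -/
theorem expectedReturn_eq_sum_occupancy (ρ : Fin H → S → JointAction A → ℝ)
    (π : JointPolicy H S A) :
    expectedReturn P s₁ ρ π = ∑ h, ∑ s, ∑ a, occupancy P s₁ π h s a * ρ h s a := by
  have key : ∀ n (hn : n ≤ H), ∑ τ, historyProb P s₁ π n hn τ *
      ∑ k : Fin n, ρ (Fin.castLE hn k) (τ k).1 (τ k).2 =
      ∑ k : Fin n, ∑ s, ∑ a,
        occupancy P s₁ π (Fin.castLE hn k) s a * ρ (Fin.castLE hn k) s a := by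
    intro n
    induction n with
    | zero => intro hn; simp
    | succ n ih =>
      intro hn
      rw [sum_historyProb_succ, Fin.sum_univ_castSucc]
      simp only [Fin.sum_univ_castSucc, Fin.snoc_castSucc, Fin.snoc_last, mul_add,
        Finset.sum_add_distrib]
      refine congrArg₂ _ ?_ ?_
      · refine Eq.trans ?_ (ih (Nat.le_of_succ_le hn))
        refine Finset.sum_congr rfl fun τ _ => ?_
        have h2 : ∀ s, ∑ a, π ⟨n, hn⟩ τ s a = 1 := fun s => (π ⟨n, hn⟩ τ s).2.2
        simp only [← Finset.sum_mul, h2, one_mul, sum_stateKernel]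
        rfl
      · simp only [occupancy, Finset.mul_sum, Finset.sum_mul]
        rw [Finset.sum_comm]
        refine Finset.sum_congr rfl fun s _ => ?_
        rw [Finset.sum_comm]
        refine Finset.sum_congr rfl fun a _ => Finset.sum_congr rfl fun τ _ => ?_
        simp only [← mul_assoc]
        rfl
  simp only [expectedReturn, trajectoryProb_eq_historyProb]
  exact key H le_rfl

/-- A value function that satisfies the one-step optimality inequality at every history bounds the
expected return. -/
theorem expectedReturn_le_of_forall_bellman_le (ρ : Fin H → S → JointAction A → ℝ)
    (π : JointPolicy H S A) (W : ℕ → S → ℝ) (hW : W H = 0)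
    (h : ∀ (k : Fin H) τ s,
      ∑ a, π k τ s a * (ρ k s a + ∑ s', P k s a s' * W (k + 1) s') ≤ W k s) :
    expectedReturn P s₁ ρ π ≤ W 0 s₁ := by
  have step : ∀ (k : Fin H),
      ∑ s, ∑ a, occupancy P s₁ π k s a * (ρ k s a + ∑ s', P k s a s' * W (k + 1) s') ≤
        ∑ s, stateMarginal P s₁ π k k.isLt.le s * W k s := by
    intro k
    refine Finset.sum_le_sum fun s _ => ?_
    simp only [occupancy, stateMarginal, Finset.sum_mul]
    rw [Finset.sum_comm]
    refine Finset.sum_le_sum fun τ _ => ?_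
    have := mul_le_mul_of_nonneg_left (h k τ s) (mul_nonneg
      (historyProb_nonneg P s₁ π k k.isLt.le τ) (stateKernel_nonneg P s₁ k k.isLt.le τ s))
    rw [Finset.mul_sum] at this
    simpa only [mul_assoc] using this
  -- The reward of the first `n` steps plus the expected continuation value `W n` does not increase
  -- with `n`.
  have key : ∀ n (hn : n ≤ H), ∑ k : Fin n, ∑ s, ∑ a,
        occupancy P s₁ π (Fin.castLE hn k) s a * ρ (Fin.castLE hn k) s a +
      ∑ s, stateMarginal P s₁ π n hn s * W n s ≤ W 0 s₁ := by
    intro n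
    induction n with
    | zero =>
      classical
      intro hn
      simp [stateMarginal_zero, Finset.sum_ite_eq']
    | succ n ih =>
      intro hn
      refine le_trans ?_ (ih (Nat.le_of_succ_le hn))
      rw [Fin.sum_univ_castSucc, add_assoc]
      refine add_le_add le_rfl (le_trans (le_of_eq ?_) (step ⟨n, hn⟩))
      simp only [mul_add, Finset.sum_add_distrib]
      refine congrArg₂ _ rfl ?_
      simp only [stateMarginal_succ P s₁ π n hn, Finset.sum_mul, Finset.mul_sum]
      rw [Finset.sum_comm]
      refine Finset.sum_congr rfl fun s _ => ?_
      rw [Finset.sum_comm]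
      simp only [mul_assoc]
  have := key H le_rfl
  rw [expectedReturn_eq_sum_occupancy]
  simpa [hW] using this

theorem le_expectedReturn_of_forall_le_bellman (ρ : Fin H → S → JointAction A → ℝ)
    (π : JointPolicy H S A) (W : ℕ → S → ℝ) (hW : W H = 0)
    (h : ∀ (k : Fin H) τ s,
      W k s ≤ ∑ a, π k τ s a * (ρ k s a + ∑ s', P k s a s' * W (k + 1) s')) :
    W 0 s₁ ≤ expectedReturn P s₁ ρ π := by
  have := expectedReturn_le_of_forall_bellman_le P s₁ (-ρ) π (-W) (by simp [hW]) (by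
    intro k τ s
    have := h k τ s
    simp only [Pi.neg_apply, mul_neg, Finset.sum_neg_distrib, ← neg_add]
    exact neg_le_neg this)
  have e : expectedReturn P s₁ (-ρ) π = -expectedReturn P s₁ ρ π := by
    simp [expectedReturn, Finset.sum_neg_distrib]
  rw [e] at this
  simpa using this

/-- A Markov joint policy that plays the conditional law of the joint action given the state has the
same return. -/
theorem expectedReturn_eq_of_occupancy_eq_mul (π : JointPolicy H S A) (σ : MarkovJointPolicy H S A)
    (h : ∀ k s a, occupancy P s₁ π k s a = stateMarginal P s₁ π k k.isLt.le s * σ k s a)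
    (ρ : Fin H → S → JointAction A → ℝ) :
    expectedReturn P s₁ ρ σ.toJointPolicy = expectedReturn P s₁ ρ π := by
  have hσ : ∀ k s a, occupancy P s₁ σ.toJointPolicy k s a =
      stateMarginal P s₁ σ.toJointPolicy k k.isLt.le s * σ k s a := by
    intro k s a
    simp only [occupancy, stateMarginal, Finset.sum_mul]
    rfl
  have key : ∀ n (hn : n ≤ H) s,
      stateMarginal P s₁ σ.toJointPolicy n hn s = stateMarginal P s₁ π n hn s := by
    intro n
    induction n with
    | zero => intro hn s; rw [stateMarginal_zero, stateMarginal_zero]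
    | succ n ih =>
      intro hn s
      rw [stateMarginal_succ, stateMarginal_succ]
      simp only [h, hσ, ih]
  simp only [expectedReturn_eq_sum_occupancy, h, hσ, key]

end HistoryLaws

/-! ### The polytope of history laws under modifications -/

section ModificationLaws

variable {N H : ℕ} {S : Type*} {A : Fin N → Type*} [∀ i, Fintype (A i)]

theorem sum_modifyDist_mul (j : Fin N) (ψ : A j → stdSimplex ℝ (A j))
    (μ : stdSimplex ℝ (JointAction A)) (u : JointAction A → ℝ) :
    ∑ a, modifyDist j ψ μ a * u a =
      ∑ a, μ a * ∑ b, ψ (a j) b * u (Function.update a j b) := by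
  classical
  change ∑ a', (∑ a : JointAction A, ∑ b : A j,
      if Function.update a j b = a' then μ a * ψ (a j) b else 0) * u a' = _
  simp only [Finset.sum_mul, ite_mul, zero_mul, Finset.mul_sum]
  rw [Finset.sum_comm]
  refine Finset.sum_congr rfl fun a _ => ?_
  rw [Finset.sum_comm]
  refine Finset.sum_congr rfl fun b _ => ?_
  rw [Finset.sum_ite_eq, if_pos (Finset.mem_univ _)]
  convert mul_assoc _ _ _

variable [Fintype S] (P : Fin H → S → JointAction A → stdSimplex ℝ S) (s₁ : S)
  (π : JointPolicy H S A) (j : Fin N)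

open Classical in
/-- The law of the histories after step `n + 1`, as a bilinear function of the law after step `n` and of
the modification used at step `n + 1`. -/
noncomputable def modificationStep (n : ℕ) (hn : n < H) :
    (Trajectory S A n → ℝ) →ₗ[ℝ] (Trajectory S A n → S → A j → A j → ℝ) →ₗ[ℝ]
      (Trajectory S A (n + 1) → ℝ) :=
  LinearMap.mk₂ ℝ (fun q κ τ => q (Fin.init τ) *
      (stateKernel P s₁ n hn.le (Fin.init τ) (τ (Fin.last n)).1 *
        ∑ a : JointAction A, ∑ b : A j, if Function.update a j b = (τ (Fin.last n)).2 then
          π ⟨n, hn⟩ (Fin.init τ) (τ (Fin.last n)).1 a *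
            κ (Fin.init τ) (τ (Fin.last n)).1 (a j) b else 0))
    (fun q q' κ => by funext τ; simp only [Pi.add_apply, add_mul])
    (fun c q κ => by funext τ; simp only [Pi.smul_apply, smul_eq_mul, mul_assoc])
    (fun q κ κ' => by
      funext τ
      simp only [Pi.add_apply]
      rw [← mul_add, ← mul_add, ← Finset.sum_add_distrib]
      refine congrArg _ (congrArg _ (Finset.sum_congr rfl fun a _ => ?_))
      rw [← Finset.sum_add_distrib]
      refine Finset.sum_congr rfl fun b _ => ?_
      split_ifs <;> ring)
    (fun c q κ => by
      funext τ
      simp only [Pi.smul_apply, smul_eq_mul]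
      simp only [Finset.mul_sum]
      refine Finset.sum_congr rfl fun a _ => Finset.sum_congr rfl fun b _ => ?_
      split_ifs <;> ring)

theorem historyProb_comp_succ (φ : StochasticModification H S A j) (n : ℕ) (hn : n < H) :
    historyProb P s₁ (φ.comp π) (n + 1) hn =
      modificationStep P s₁ π j n hn (historyProb P s₁ (φ.comp π) n hn.le)
        (fun τ s x => φ ⟨n, hn⟩ τ s x) := rfl

/-- The laws of the histories of length `n` that the stochastic modifications of player `j` lead to. -/
def historyLaws (n : ℕ) (hn : n ≤ H) : Set (Trajectory S A n → ℝ) :=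
  Set.range fun φ : StochasticModification H S A j => historyProb P s₁ (φ.comp π) n hn

/-- The one-step modifications, as real-valued functions. -/
def modificationKernels (T S X : Type*) [Fintype X] : Set (T → S → X → X → ℝ) :=
  Set.univ.pi fun _ => Set.univ.pi fun _ => Set.univ.pi fun _ => stdSimplex ℝ X

/-- The vertices are the deterministic modifications, since convex hulls commute with products. -/
theorem exists_finite_convexHull_eq_modificationKernels (T S X : Type*) [Finite T] [Finite S]
    [Fintype X] : ∃ D : Set (T → S → X → X → ℝ), D.Finite ∧
      convexHull ℝ D = modificationKernels T S X := by
  classical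
  refine ⟨Set.univ.pi fun _ => Set.univ.pi fun _ => Set.univ.pi fun _ =>
    Set.range fun x : X => Pi.single x (1 : ℝ), ?_, ?_⟩
  · exact Set.Finite.pi fun _ => Set.Finite.pi fun _ => Set.Finite.pi fun _ => Set.finite_range _
  · simp only [convexHull_pi, convexHull_rangle_single_eq_stdSimplex, modificationKernels]

theorem historyLaws_succ (n : ℕ) (hn : n < H) :
    historyLaws P s₁ π j (n + 1) hn =
      Set.image2 (fun q κ => modificationStep P s₁ π j n hn q κ) (historyLaws P s₁ π j n hn.le)
        (modificationKernels (Trajectory S A n) S (A j)) := by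
  classical
  ext q
  constructor
  · rintro ⟨φ, rfl⟩
    exact ⟨_, ⟨φ, rfl⟩, _, fun τ _ s _ x _ => (φ ⟨n, hn⟩ τ s x).2,
      (historyProb_comp_succ P s₁ π j φ n hn).symm⟩
  · rintro ⟨_, ⟨φ, rfl⟩, κ, hκ, rfl⟩
    -- The modification at step `n` can be chosen freely, as it does not affect the law of the
    -- histories of length `n`.
    let φ' : StochasticModification H S A j := Function.update φ ⟨n, hn⟩
      fun τ s x => ⟨κ τ s x, hκ τ trivial s trivial x trivial⟩
    refine ⟨φ', ?_⟩
    change historyProb P s₁ (φ'.comp π) (n + 1) hn = _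
    rw [historyProb_comp_succ, historyProb_congr P s₁ (π := φ'.comp π) (π' := φ.comp π)]
    · congr 1
      funext τ s x
      simp only [φ', Function.update_self]
      rfl
    · intro k hk
      have hne : k ≠ ⟨n, hn⟩ := fun h => by simp [h] at hk
      funext τ s
      simp only [StochasticModification.comp, φ', Function.update_of_ne hne]

/-- Mixtures of history laws arise from modifications: it suffices to modify according to the posterior
mixture given the history. -/
theorem convex_historyLaws (n : ℕ) (hn : n ≤ H) : Convex ℝ (historyLaws P s₁ π j n hn) := by
  classical
  induction n with
  | zero =>
    rintro _ ⟨φ, rfl⟩ _ ⟨φ', rfl⟩ t u _ _ htu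
    refine ⟨φ, ?_⟩
    funext τ
    simp [historyProb, htu]
  | succ n ih =>
    rw [historyLaws_succ]
    rintro _ ⟨q, hq, κ, hκ, rfl⟩ _ ⟨q', hq', κ', hκ', rfl⟩ t u ht hu htu
    have hq0 : ∀ τ, 0 ≤ q τ := by
      obtain ⟨φ, rfl⟩ := hq
      exact historyProb_nonneg P s₁ _ _ _
    have hq0' : ∀ τ, 0 ≤ q' τ := by
      obtain ⟨φ, rfl⟩ := hq'
      exact historyProb_nonneg P s₁ _ _ _
    -- Posterior mixture of the two kernels. At a history of mixed mass zero both terms of `hmul`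
    -- vanish, and `κ` serves as an arbitrary kernel.
    let κ'' : Trajectory S A n → S → A j → A j → ℝ := fun τ s x =>
      if t * q τ + u * q' τ = 0 then κ τ s x else
        (t * q τ / (t * q τ + u * q' τ)) • κ τ s x + (u * q' τ / (t * q τ + u * q' τ)) • κ' τ s x
    have hmul : ∀ τ s x b, (t * q τ + u * q' τ) * κ'' τ s x b =
        t * q τ * κ τ s x b + u * q' τ * κ' τ s x b := by
      intro τ s x b
      have h1 := mul_nonneg ht (hq0 τ)
      have h2 := mul_nonneg hu (hq0' τ)
      by_cases h : t * q τ + u * q' τ = 0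
      · have e1 : t * q τ = 0 := by linarith
        have e2 : u * q' τ = 0 := by linarith
        simp [e1, e2]
      · simp only [κ'', if_neg h, Pi.add_apply, Pi.smul_apply, smul_eq_mul]
        field_simp
    refine ⟨t • q + u • q', ih (Nat.le_of_succ_le hn) hq hq' ht hu htu, κ'', ?_, ?_⟩
    · intro τ _ s _ x _
      have h1 := mul_nonneg ht (hq0 τ)
      have h2 := mul_nonneg hu (hq0' τ)
      simp only [κ'']
      split_ifs with h
      · exact hκ τ trivial s trivial x trivial
      · have h3 : 0 ≤ t * q τ + u * q' τ := add_nonneg h1 h2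
        exact convex_stdSimplex ℝ (A j) (hκ τ trivial s trivial x trivial)
          (hκ' τ trivial s trivial x trivial) (div_nonneg h1 h3) (div_nonneg h2 h3)
          (by rw [← add_div, div_self h])
    · funext τ
      simp only [modificationStep, LinearMap.mk₂_apply, Pi.add_apply, Pi.smul_apply, smul_eq_mul,
        Finset.mul_sum]
      rw [← Finset.sum_add_distrib]
      refine Finset.sum_congr rfl fun a _ => ?_
      rw [← Finset.sum_add_distrib]
      refine Finset.sum_congr rfl fun b _ => ?_
      split_ifs
      · have := hmul (Fin.init τ) (τ (Fin.last n)).1 (a j) b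
        linear_combination (stateKernel P s₁ n (Nat.le_of_succ_le hn) (Fin.init τ)
          (τ (Fin.last n)).1 * π ⟨n, hn⟩ (Fin.init τ) (τ (Fin.last n)).1 a) * this
      · simp

theorem exists_finite_historyLaws_subset (n : ℕ) (hn : n ≤ H) :
    ∃ F ⊆ historyLaws P s₁ π j n hn, F.Finite ∧ historyLaws P s₁ π j n hn ⊆ convexHull ℝ F := by
  induction n with
  | zero =>
    refine ⟨_, subset_rfl, ?_, subset_convexHull ℝ _⟩
    refine (Set.finite_singleton 1).subset ?_
    rintro _ ⟨φ, rfl⟩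
    rfl
  | succ n ih =>
    obtain ⟨F, hF, hFfin, hsub⟩ := ih (Nat.le_of_succ_le hn)
    obtain ⟨D, hDfin, hD⟩ :=
      exists_finite_convexHull_eq_modificationKernels (Trajectory S A n) S (A j)
    let B := modificationStep P s₁ π j n hn
    refine ⟨Set.image2 (fun q κ => B q κ) F D, ?_, hFfin.image2 _ hDfin, ?_⟩
    · rw [historyLaws_succ]
      exact Set.image2_subset hF (hD ▸ subset_convexHull ℝ D)
    · rw [historyLaws_succ]
      rintro _ ⟨q, hq, κ, hκ, rfl⟩
      rw [← hD] at hκ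
      -- Bilinearity is used in one argument at a time: first `q` is reduced to points of `F`, then
      -- `κ` to points of `D`.
      have h1 : B q κ ∈ convexHull ℝ ((B.flip κ) '' F) := by
        rw [← LinearMap.image_convexHull]
        exact ⟨q, hsub hq, rfl⟩
      refine convexHull_min ?_ (convex_convexHull ℝ _) h1
      rintro _ ⟨f, hf, rfl⟩
      have h2 : B f κ ∈ convexHull ℝ ((B f) '' D) := by
        rw [← LinearMap.image_convexHull]
        exact ⟨κ, hκ, rfl⟩
      refine convexHull_mono ?_ h2
      rintro _ ⟨d, hd, rfl⟩
      exact ⟨f, hf, d, hd, rfl⟩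

/-- The history laws of all stochastic modifications of a player form a polytope. -/
theorem exists_finite_convexHull_eq_historyLaws (n : ℕ) (hn : n ≤ H) :
    ∃ F : Set (Trajectory S A n → ℝ), F.Finite ∧ convexHull ℝ F = historyLaws P s₁ π j n hn := by
  obtain ⟨F, hF, hFfin, hsub⟩ := exists_finite_historyLaws_subset P s₁ π j n hn
  exact ⟨F, hFfin, (convexHull_min hF (convex_historyLaws P s₁ π j n hn)).antisymm hsub⟩

end ModificationLaws

/-! ### Positive supporting weights and scalarization -/

section Scalarization

/-- A point of `ℝ^M` that no point of a polytope dominates is supported by weights in the open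
simplex. -/
theorem exists_openSimplex_forall_convexHull_le {M : ℕ} [NeZero M] {F : Set (Fin M → ℝ)}
    (hF : F.Finite) (v : Fin M → ℝ) (h : ∀ u ∈ convexHull ℝ F, ¬ ParetoDominates u v) :
    ∃ w : openSimplex M, ∀ u ∈ convexHull ℝ F, ∑ m, w.1 m * u m ≤ ∑ m, w.1 m * v m := by
  have := hF.fintype
  obtain ⟨w, hw, hle⟩ := exists_pos_forall_sum_mul_nonpos (fun (f : F) m => f.1 m - v m) (by
    intro c hc hnonneg m
    rcases (Finset.sum_nonneg fun i _ => hc i).eq_or_lt' with h0 | hpos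
    · have hz := (Finset.sum_eq_zero_iff_of_nonneg fun i _ => hc i).1 h0
      exact (Finset.sum_eq_zero fun i hi => by rw [hz i hi, zero_mul]).le
    -- Dividing by the total weight turns the combination into a point of the hull that dominates
    -- `v`.
    · by_contra hlt
      have hsub : ∀ m, ∑ i, c i * (i.1 m - v m) =
          (∑ i, c i) * ((Finset.univ.centerMass c fun i : F => i.1) m - v m) := by
        intro m
        simp only [Finset.centerMass, mul_sub, Finset.sum_sub_distrib, Finset.sum_mul,
          Pi.smul_apply, Finset.sum_apply, smul_eq_mul]
        rw [← Finset.sum_mul, ← Finset.sum_mul, mul_inv_cancel_left₀ hpos.ne']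
      refine h (Finset.univ.centerMass c fun i : F => i.1)
        (Finset.centerMass_mem_convexHull _ (fun i _ => hc i) hpos fun i _ => i.2) ⟨fun m => ?_, m, ?_⟩
      · have := hnonneg m
        rw [hsub] at this
        exact sub_nonneg.1 (nonneg_of_mul_nonneg_right this hpos)
      · rw [hsub] at hlt
        exact sub_pos.1 ((mul_pos_iff_of_pos_left hpos).1 (not_le.1 hlt)))
  have hpos : 0 < ∑ m, w m := Finset.sum_pos (fun m _ => hw m) Finset.univ_nonempty
  refine ⟨⟨fun m => w m / ∑ m, w m, ⟨fun m => (div_pos (hw m) hpos).le, ?_⟩,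
    fun m => div_pos (hw m) hpos⟩, fun u hu => ?_⟩
  · rw [← Finset.sum_div, div_self hpos.ne']
  · have hu' : ∑ m, w m * u m ≤ ∑ m, w m * v m := by
      refine convexHull_min (t := {u | ∑ m, w m * u m ≤ ∑ m, w m * v m}) ?_ ?_ hu
      · intro f hf
        have := hle ⟨f, hf⟩
        simpa [mul_sub] using this
      · refine convex_halfSpace_le ⟨fun x y => ?_, fun c x => ?_⟩ _
        · simp [mul_add, Finset.sum_add_distrib]
        · simp only [Pi.smul_apply, smul_eq_mul, Finset.mul_sum]
          exact Finset.sum_congr rfl fun m _ => mul_left_comm _ _ _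
    simp only [div_mul_eq_mul_div, ← Finset.sum_div]
    exact div_le_div_of_nonneg_right hu' hpos.le

variable {N M H : ℕ} {S : Type*} {A : Fin N → Type*} [Fintype S] [∀ i, Fintype (A i)]

theorem MOMG.scalarize_value (G : MOMG N M H S A) (Λ : Fin N → openSimplex M)
    (π : JointPolicy H S A) (j : Fin N) :
    (G.scalarize Λ).value π j = ∑ m, (Λ j).1 m * G.value π j m := by
  simp only [MarkovGame.value, MOMG.value, expectedReturn, MOMG.scalarize, Finset.mul_sum]
  rw [Finset.sum_comm (s := (Finset.univ : Finset (Fin M)))]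
  refine Finset.sum_congr rfl fun τ _ => ?_
  rw [Finset.sum_comm]
  exact Finset.sum_congr rfl fun m _ => Finset.sum_congr rfl fun h _ => mul_left_comm _ _ _

/-- Values are linear in the law of the full history, and linear images of polytopes are polytopes.
-/
theorem MOMG.exists_finite_convexHull_eq_range_value (G : MOMG N M H S A) (π : JointPolicy H S A)
    (j : Fin N) : ∃ F : Set (Fin M → ℝ), F.Finite ∧ convexHull ℝ F =
      Set.range fun φ : StochasticModification H S A j => G.value (φ.comp π) j := by
  obtain ⟨F, hF, hFeq⟩ := exists_finite_convexHull_eq_historyLaws G.P G.s₁ π j H le_rfl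
  let L : (Trajectory S A H → ℝ) →ₗ[ℝ] (Fin M → ℝ) :=
    LinearMap.pi fun m => ∑ τ : Trajectory S A H,
      (∑ h, G.r j h (τ h).1 (τ h).2 m) • (LinearMap.proj τ : (Trajectory S A H → ℝ) →ₗ[ℝ] ℝ)
  refine ⟨L '' F, hF.image L, ?_⟩
  rw [← LinearMap.image_convexHull, hFeq, historyLaws, ← Set.range_comp]
  refine congrArg Set.range (funext fun φ => funext fun m => ?_)
  simp [L, MOMG.value, expectedReturn, trajectoryProb_eq_historyProb, LinearMap.sum_apply, mul_comm]

theorem MOMG.PCE_eq_iUnion_CE [NeZero M] (G : MOMG N M H S A) :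
    G.PCE = ⋃ Λ : Fin N → openSimplex M, (G.scalarize Λ).CE := by
  ext π
  rw [Set.mem_iUnion]
  constructor
  · intro hπ
    have : ∀ j, ∃ w : openSimplex M, ∀ φ : StochasticModification H S A j,
        ∑ m, w.1 m * G.value (φ.comp π) j m ≤ ∑ m, w.1 m * G.value π j m := by
      intro j
      obtain ⟨F, hF, hFeq⟩ := G.exists_finite_convexHull_eq_range_value π j
      obtain ⟨w, hw⟩ := exists_openSimplex_forall_convexHull_le hF (G.value π j) (by
        rw [hFeq]
        rintro _ ⟨φ, rfl⟩
        exact hπ j φ)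
      exact ⟨w, fun φ => hw _ (hFeq ▸ ⟨φ, rfl⟩)⟩
    choose Λ hΛ using this
    refine ⟨Λ, fun j φ => ?_⟩
    rw [MOMG.scalarize_value, MOMG.scalarize_value]
    exact hΛ j φ
  · rintro ⟨Λ, hΛ⟩ j φ ⟨hle, m, hlt⟩
    have := hΛ j φ
    rw [MOMG.scalarize_value, MOMG.scalarize_value] at this
    refine absurd this (not_le.2 (Finset.sum_lt_sum (fun m _ => ?_) ⟨m, Finset.mem_univ m, ?_⟩))
    · exact mul_le_mul_of_nonneg_left (hle m) ((Λ j).2.2 m).le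
    · exact mul_lt_mul_of_pos_left hlt ((Λ j).2.2 m)

end Scalarization

/-! ### Modifications of product distributions -/

section ProductDistributions

variable {N : ℕ} {A : Fin N → Type*} [∀ i, Fintype (A i)]

theorem productDist_update_apply (μ : ∀ i, stdSimplex ℝ (A i)) (j : Fin N)
    (ν : stdSimplex ℝ (A j)) (a : JointAction A) :
    productDist (Function.update μ j ν) a =
      ν (a j) * ∏ i ∈ Finset.univ.erase j, μ i (a i) := by
  change ∏ i, (Function.update μ j ν i) (a i) = _
  rw [← Finset.mul_prod_erase _ _ (Finset.mem_univ j), Function.update_self]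
  refine congrArg _ (Finset.prod_congr rfl fun i hi => ?_)
  rw [Function.update_of_ne (Finset.ne_of_mem_erase hi)]

/-- Draw `x` from `μ` and then `b` from `ψ x`. -/
def bindDist {X : Type*} [Fintype X] (μ : stdSimplex ℝ X) (ψ : X → stdSimplex ℝ X) :
    stdSimplex ℝ X :=
  ⟨fun b => ∑ x, μ x * ψ x b, fun b => Finset.sum_nonneg fun x _ => mul_nonneg (μ.2.1 x) ((ψ x).2.1 b),
    by
      rw [Finset.sum_comm]
      have h : ∀ x, ∑ b, μ x * ψ x b = μ x := fun x => by
        rw [← Finset.mul_sum]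
        have h1 : ∑ b, ψ x b = 1 := (ψ x).2.2
        rw [h1, mul_one]
      simp only [h]
      exact μ.2.2⟩

/-- The replacement depends on `a j` alone, so independence survives and only the marginal of `j`
changes. -/
theorem modifyDist_productDist (μ : ∀ i, stdSimplex ℝ (A i)) (j : Fin N)
    (ψ : A j → stdSimplex ℝ (A j)) :
    modifyDist j ψ (productDist μ) =
      productDist (Function.update μ j (bindDist (μ j) ψ)) := by
  classical
  refine stdSimplex.ext (funext fun a' => ?_)
  change _ = productDist (Function.update μ j (bindDist (μ j) ψ)) a'
  rw [productDist_update_apply]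
  change (∑ a : JointAction A, ∑ b : A j,
    if Function.update a j b = a' then productDist μ a * ψ (a j) b else 0) =
      (∑ x, μ j x * ψ x (a' j)) * _
  rw [Finset.sum_mul]
  symm
  -- Only joint actions that agree with `a'` off `j` can be turned into `a'`; they are indexed by
  -- their entry `x` at `j`.
  refine Fintype.sum_of_injective (Function.update a' j) (Function.update_injective a' j) _ _ ?_ ?_
  · intro a ha
    refine Finset.sum_eq_zero fun b _ => if_neg fun hab => ha ⟨a j, ?_⟩
    rw [← hab, Function.update_idem, Function.update_eq_self]
  · intro x
    rw [Finset.sum_eq_single (a' j)]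
    · rw [if_pos (by rw [Function.update_idem, Function.update_eq_self])]
      have : productDist μ (Function.update a' j x) =
          μ j x * ∏ i ∈ Finset.univ.erase j, μ i (a' i) := by
        change ∏ i, μ i (Function.update a' j x i) = _
        rw [← Finset.mul_prod_erase _ _ (Finset.mem_univ j), Function.update_self]
        refine congrArg _ (Finset.prod_congr rfl fun i hi => ?_)
        rw [Function.update_of_ne (Finset.ne_of_mem_erase hi)]
      rw [this, Function.update_self]
      ring
    · intro b _ hb
      refine if_neg fun hab => hb ?_
      rw [← hab, Function.update_self]
    · exact fun h => absurd (Finset.mem_univ _) h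

/-- This is the constant modification that ignores `a j` and redraws from `μ j`. It isolates the
marginal of `j` with the other actions frozen. -/
theorem sum_productDist_mul_eq_sum_update (μ : ∀ i, stdSimplex ℝ (A i)) (j : Fin N)
    (f : JointAction A → ℝ) :
    ∑ a, productDist μ a * f a =
      ∑ a, productDist μ a * ∑ x, μ j x * f (Function.update a j x) := by
  rw [← sum_modifyDist_mul j (fun _ => μ j), modifyDist_productDist]
  have : bindDist (μ j) (fun _ => μ j) = μ j := by
    refine stdSimplex.ext (funext fun b => ?_)
    change ∑ x, μ j x * μ j b = μ j b
    rw [← Finset.sum_mul]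
    have h1 : ∑ x, μ j x = 1 := (μ j).2.2
    rw [h1, one_mul]
  rw [this, Function.update_eq_self]

end ProductDistributions

/-! ### Correlated equilibria of stage games and Markov games -/

section CorrelatedEquilibrium

variable {N : ℕ} {A : Fin N → Type*} [∀ i, Fintype (A i)]

/-- Every finite strategic game has a correlated equilibrium (Hart and Schmeidler). -/
theorem exists_correlatedEquilibrium [∀ i, Nonempty (A i)] (u : Fin N → JointAction A → ℝ) :
    ∃ μ : stdSimplex ℝ (JointAction A), ∀ (j : Fin N) (ψ : A j → stdSimplex ℝ (A j)),
      ∑ a, modifyDist j ψ μ a * u j a ≤ ∑ a, μ a * u j a := by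
  classical
  obtain ⟨μ, hμ⟩ := exists_stdSimplex_sum_nonpos (ι := JointAction A) (κ := Σ j, A j × A j)
    (fun a k => if a k.1 = k.2.1 then u k.1 (Function.update a k.1 k.2.2) - u k.1 a else 0) (by
      intro y hy
      -- The multipliers of player `j` are read as jump rates from `x` to `b`. Under the product of
      -- the stationary distributions the expected total gain is zero, so it cannot be positive at
      -- every joint action.
      choose q hq using fun j => exists_stationary_stdSimplex (fun x b => y ⟨j, x, b⟩)
        fun x b => hy ⟨j, x, b⟩
      have hgain : ∀ a : JointAction A, ∑ k : Σ j, A j × A j, y k *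
          (if a k.1 = k.2.1 then u k.1 (Function.update a k.1 k.2.2) - u k.1 a else 0) =
          ∑ j, ∑ b, y ⟨j, a j, b⟩ * (u j (Function.update a j b) - u j a) := by
        intro a
        rw [Fintype.sum_sigma]
        refine Finset.sum_congr rfl fun j _ => ?_
        rw [Fintype.sum_prod_type, Finset.sum_comm]
        refine Finset.sum_congr rfl fun b _ => ?_
        simp only [mul_ite, mul_zero, Finset.sum_ite_eq, Finset.mem_univ, if_true]
      have hzero : ∑ a, productDist q a *
          ∑ j, ∑ b, y ⟨j, a j, b⟩ * (u j (Function.update a j b) - u j a) = 0 := by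
        simp only [Finset.mul_sum (s := (Finset.univ : Finset (Fin N)))]
        rw [Finset.sum_comm]
        refine Finset.sum_eq_zero fun j _ => ?_
        rw [sum_productDist_mul_eq_sum_update q j]
        refine Finset.sum_eq_zero fun a _ => ?_
        simp only [Function.update_self, Function.update_idem]
        rw [hq j fun x => u j (Function.update a j x), mul_zero]
      by_contra! hpos
      simp only [hgain] at hpos
      have h0 := (Finset.sum_eq_zero_iff_of_nonneg fun a _ =>
        mul_nonneg ((productDist q).2.1 a) (hpos a).le).1 hzero
      have h1 : ∑ a, productDist q a = 1 := (productDist q).2.2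
      refine zero_ne_one ((Finset.sum_eq_zero fun a ha => ?_).symm.trans h1)
      exact (mul_eq_zero.1 (h0 a ha)).resolve_right (hpos a).ne')
  refine ⟨μ, fun j ψ => ?_⟩
  rw [sum_modifyDist_mul, ← sub_nonpos, ← Finset.sum_sub_distrib]
  have : ∑ a, (μ a * ∑ b, ψ (a j) b * u j (Function.update a j b) - μ a * u j a) =
      ∑ x, ∑ b, ψ x b * ∑ a, μ a *
        (if a j = x then u j (Function.update a j b) - u j a else 0) := by
    simp only [Finset.mul_sum (s := (Finset.univ : Finset (JointAction A)))]
    simp only [Finset.sum_comm (t := (Finset.univ : Finset (JointAction A)))]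
    refine Finset.sum_congr rfl fun a _ => ?_
    rw [Finset.sum_comm]
    simp only [mul_ite, mul_zero, Finset.sum_ite_eq, Finset.mem_univ, if_true]
    have h1 : ∑ b, ψ (a j) b = 1 := (ψ (a j)).2.2
    simp only [mul_sub, Finset.sum_sub_distrib, ← Finset.sum_mul, h1, one_mul, Finset.mul_sum]
    exact congrArg₂ _ (Finset.sum_congr rfl fun b _ => mul_left_comm _ _ _) rfl
  rw [this]
  exact Finset.sum_nonpos fun x _ => Finset.sum_nonpos fun b _ =>
    mul_nonpos_of_nonneg_of_nonpos ((ψ x).2.1 b) (hμ ⟨j, x, b⟩)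

theorem exists_backward_recursion {α : Type*} {H : ℕ} (T : Fin H → α → α) (w : α) :
    ∃ W : ℕ → α, W H = w ∧ ∀ h : Fin H, W h = T h (W (h + 1)) := by
  induction H with
  | zero => exact ⟨fun _ => w, rfl, fun h => h.elim0⟩
  | succ H ih =>
    obtain ⟨W, hW, hT⟩ := ih fun h => T h.succ
    refine ⟨fun n => Nat.casesOn n (T 0 (W 0)) W, hW, fun h => ?_⟩
    exact Fin.cases rfl (fun h => hT h) h

variable {H : ℕ} {S : Type*} [Fintype S]

/-- Stage payoffs are the reward plus the continuation value `W`. The stage equilibrium property is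
a Bellman inequality at every history, so `W` bounds every modified return from above, while the
unmodified policy attains `W`. -/
theorem MarkovGame.exists_toJointPolicy_mem_CE [∀ i, Nonempty (A i)] (G : MarkovGame N H S A) :
    ∃ π : MarkovJointPolicy H S A, π.toJointPolicy ∈ G.CE := by
  choose μ hμ using exists_correlatedEquilibrium (A := A)
  let Q : Fin H → (Fin N → S → ℝ) → S → Fin N → JointAction A → ℝ := fun h W s j a =>
    G.r j h s a + ∑ s', G.P h s a s' * W j s'
  obtain ⟨W, hW, hT⟩ := exists_backward_recursion
    (fun h W j s => ∑ a, μ (Q h W s) a * Q h W s j a) (0 : Fin N → S → ℝ)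
  let π : MarkovJointPolicy H S A := fun h s => μ (Q h (W (h + 1)) s)
  refine ⟨π, fun j φ => le_trans
    (expectedReturn_le_of_forall_bellman_le G.P G.s₁ (G.r j) _ (fun n => W n j) ?_ ?_)
    (le_expectedReturn_of_forall_le_bellman G.P G.s₁ (G.r j) _ (fun n => W n j) ?_ ?_)⟩
  · simp only [hW, Pi.zero_apply]
  · intro h τ s
    simp only [hT h]
    exact hμ (Q h (W (h + 1)) s) j (φ h τ s)
  · simp only [hW, Pi.zero_apply]
  · intro h τ s
    simp only [hT h]
    exact le_rfl

end CorrelatedEquilibrium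

/-! ### Pareto–Nash equilibria against history-dependent modifications -/

section ParetoNash

variable {N M H : ℕ} {S : Type*} {A : Fin N → Type*} [Fintype S] [∀ i, Fintype (A i)]

/-- Against independent Markov opponents, every stochastic modification of a player has the same return
as some Markov policy of that player. -/
theorem exists_playerPolicy_expectedReturn_eq (P : Fin H → S → JointAction A → stdSimplex ℝ S)
    (s₁ : S) (π : ∀ i, PlayerPolicy H S A i) (k : Fin N) (φ : StochasticModification H S A k) :
    ∃ π' : PlayerPolicy H S A k, ∀ ρ,
      expectedReturn P s₁ ρ (productPolicy (Function.update π k π')).toJointPolicy =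
        expectedReturn P s₁ ρ (φ.comp (productPolicy π).toJointPolicy) := by
  classical
  let σ : JointPolicy H S A := φ.comp (productPolicy π).toJointPolicy
  let ν : ∀ h : Fin H, Trajectory S A h → S → stdSimplex ℝ (A k) := fun h τ s =>
    bindDist (π k h s) (φ h τ s)
  let m : Fin H → S → ℝ := fun h s => stateMarginal P s₁ σ h h.isLt.le s
  let p : ∀ h : Fin H, Trajectory S A h → S → ℝ := fun h τ s =>
    historyProb P s₁ σ h h.isLt.le τ * stateKernel P s₁ h h.isLt.le τ s
  have hp : ∀ h τ s, 0 ≤ p h τ s := fun h τ s =>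
    mul_nonneg (historyProb_nonneg P s₁ _ _ _ _) (stateKernel_nonneg P s₁ _ _ _ _)
  -- The Markov deviation is the conditional law of the action of `k` given the state under `σ`. At
  -- unreachable states any law works, and `π k h s` is taken.
  have hex : ∀ h s, ∃ q : stdSimplex ℝ (A k), ∀ b, m h s * q b = ∑ τ, p h τ s * ν h τ s b := by
    intro h s
    by_cases hm : m h s = 0
    · refine ⟨π k h s, fun b => ?_⟩
      have h0 := (Finset.sum_eq_zero_iff_of_nonneg fun τ _ => hp h τ s).1 hm
      rw [hm, zero_mul, Finset.sum_eq_zero fun τ hτ => by rw [h0 τ hτ, zero_mul]]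
    · refine ⟨⟨fun b => (∑ τ, p h τ s * ν h τ s b) / m h s, fun b => ?_, ?_⟩, fun b => ?_⟩
      · exact div_nonneg (Finset.sum_nonneg fun τ _ => mul_nonneg (hp h τ s) ((ν h τ s).2.1 b))
          (stateMarginal_nonneg P s₁ _ _ _ _)
      · rw [← Finset.sum_div, Finset.sum_comm, div_eq_one_iff_eq hm]
        refine Finset.sum_congr rfl fun τ _ => ?_
        have h1 : ∑ b, ν h τ s b = 1 := (ν h τ s).2.2
        rw [← Finset.mul_sum, h1, mul_one]
      · exact mul_div_cancel₀ _ hm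
  choose π' hπ' using hex
  refine ⟨π', fun ρ => expectedReturn_eq_of_occupancy_eq_mul P s₁ σ _ (fun h s a => ?_) ρ⟩
  have h1 : productPolicy (Function.update π k π') h s =
      productDist (Function.update (fun i => π i h s) k (π' h s)) := by
    refine congrArg productDist (funext fun i => ?_)
    by_cases hi : i = k
    · subst hi
      simp only [Function.update_self]
    · simp only [Function.update_of_ne hi]
  have h2 : ∀ τ, σ h τ s = productDist (Function.update (fun i => π i h s) k (ν h τ s)) := fun τ =>
    modifyDist_productDist (fun i => π i h s) k (φ h τ s)
  rw [h1, productDist_update_apply, ← mul_assoc]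
  refine Eq.trans ?_ (congrArg (· * _) (hπ' h s (a k)).symm)
  rw [Finset.sum_mul]
  refine Finset.sum_congr rfl fun τ _ => ?_
  rw [h2, productDist_update_apply, ← mul_assoc]

theorem MOMG.toJointPolicy_mem_PCE_of_mem_PNE (G : MOMG N M H S A)
    {π : ∀ i, PlayerPolicy H S A i} (hπ : π ∈ G.PNE) :
    (productPolicy π).toJointPolicy ∈ G.PCE := by
  intro k φ hdom
  obtain ⟨π', hπ'⟩ := exists_playerPolicy_expectedReturn_eq G.P G.s₁ π k φ
  refine hπ k π' ?_
  have : G.value (productPolicy (Function.update π k π')).toJointPolicy k =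
      G.value (φ.comp (productPolicy π).toJointPolicy) k := funext fun m => hπ' _
  rwa [this]

end ParetoNash

/-! ### The main theorem -/

theorem mainTheorem5 {N M H : ℕ} [NeZero M] {S : Type*} {A : Fin N → Type*}
    [Fintype S] [∀ i, Fintype (A i)] [∀ i, Nonempty (A i)] (G : MOMG N M H S A) :
    (∃ π : MarkovJointPolicy H S A, π.toJointPolicy ∈ G.PCE) ∧
    (∀ π ∈ G.PNE, (productPolicy π).toJointPolicy ∈ G.PCE) ∧
    {π : MarkovJointPolicy H S A | π.toJointPolicy ∈ G.PCE} =
      ⋃ Λ : Fin N → openSimplex M,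
        {π : MarkovJointPolicy H S A | π.toJointPolicy ∈ (G.scalarize Λ).CE} ∧
    G.PCE = ⋃ Λ : Fin N → openSimplex M, (G.scalarize Λ).CE := by
  refine ⟨?_, fun π hπ => G.toJointPolicy_mem_PCE_of_mem_PNE hπ, ?_, G.PCE_eq_iUnion_CE⟩
  -- Any positive weights would do; the uniform ones are used.
  · have hM : (0 : ℝ) < M := Nat.cast_pos.2 (NeZero.pos M)
    have hw : (fun _ => (M : ℝ)⁻¹) ∈ openSimplex M :=
      ⟨⟨fun _ => (inv_pos.2 hM).le, by simp [hM.ne']⟩, fun _ => inv_pos.2 hM⟩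
    obtain ⟨π, hπ⟩ := (G.scalarize fun _ => ⟨_, hw⟩).exists_toJointPolicy_mem_CE
    refine ⟨π, ?_⟩
    rw [G.PCE_eq_iUnion_CE]
    exact Set.mem_iUnion.2 ⟨_, hπ⟩
  · ext π
    simp only [Set.mem_ofPred_eq, Set.mem_iUnion, G.PCE_eq_iUnion_CE]
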